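/- Let $[n]=\{1,\dots,n\}$. The number of cycles of a permutation includes its fixed points (cycles of length $1$), and an $n$-cycle on $[n]$ is a permutation of $[n]$ with a single cycle. For integers $0\le m<n$ and $k\ge 0$, let $I^{(n)}_{m,k}$ be the number of pairs $(s,\pi)$ of permutations of $[n]$ such that $s$ is an $n$-cycle, the product $s\pi^{-1}$ is an $n$-cycle, $\pi$ has exactly $k$ cycles, and every element of $[m]$ is a fixed point of $\pi$. (In other words, $I^{(n)}_{m,k}$ counts the factorizations $s=D\pi$, over all $n$-cycles $s$, into an $n$-cycle $D$ and a permutation $\pi$ that has $k$ cycles and fixes every element of $[m]$.) For integers $0\le m\le n$ and $k\ge 0$, let $\widehat{C}_m(n,k)$ be the number of permutations of $[n]$ with exactly $k$ cycles for which every element of $[m]$ is a fixed point. Let $C(n,k)$ denote the signless Stirling numbers of the first kind, with $C(n,k)=0$ for $k<0$. Then, for all integers $0\le m<n$ and $k\ge 0$ with $n-k$ even, $$ I^{(n)}_{m,k}=\frac{2\,(n-1)!\;\widehat{C}_m(n+1,k)}{(n-m)(n+1-m)}, $$ and, for all integers $0\le m\le n$ and $k\ge 0$, $$ \widehat{C}_m(n,k)=C(n-m,k-m).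 $$ -/

import Mathlib

namespace PlanePermutation

open Equiv

/-- The cycle-type of a permutation of `[n]`, as a partition of `n`; a fixed point contributes a
part `1`. -/
def cycleTypePartition {n : ℕ} (σ : Perm (Fin n)) : n.Partition where
  parts := σ.partition.parts
  parts_pos := fun h => σ.partition.parts_pos h
  parts_sum := by simpa using σ.partition.parts_sum

/-- The number of cycles of a permutation of `[n]`, fixed points included. -/
def numCycles {n : ℕ} (σ : Perm (Fin n)) : ℕ :=
  Multiset.card (cycleTypePartition σ).parts

/-- `σ` is an `n`-cycle (a long cycle), that is, its cycle-type is the one-part partition of `n`. -/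
def IsLongCycle {n : ℕ} (σ : Perm (Fin n)) : Prop :=
  cycleTypePartition σ = Nat.Partition.indiscrete n

/-- The first `m` elements of `[n]` are fixed points of `σ`. The set `[n] = {1, …, n}` is
modelled by `Fin n`, so that the subset `[m]` consists of the `i` with `i.val < m`. -/
def FixesFirst {n : ℕ} (m : ℕ) (σ : Perm (Fin n)) : Prop :=
  ∀ i : Fin n, (i : ℕ) < m → σ i = i

/-- A plane permutation on `[n]`: a pair `(s, π)` of an `n`-cycle `s` (the upper horizontal) and an
arbitrary permutation `π` (the vertical). -/
@[ext]
structure PlanePerm (n : ℕ) where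
  upper : Perm (Fin n)
  vertical : Perm (Fin n)
  isLongCycle_upper : IsLongCycle upper

/-- The diagonal of a plane permutation `(s, π)`: the permutation taking `π x` to `s x`,
that is, `s π⁻¹`. -/
def PlanePerm.diagonal {n : ℕ} (p : PlanePerm n) : Perm (Fin n) :=
  p.upper * p.vertical⁻¹

/-- The set of plane permutations on `[n]` whose diagonal has cycle-type `lam` and whose vertical
has `k` cycles and has all the elements of `[m]` as fixed points. -/
def isolatedSet {n : ℕ} (lam : n.Partition) (m k : ℕ) : Set (PlanePerm n) :=
  {p | cycleTypePartition p.diagonal = lam ∧ numCycles p.vertical = k ∧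
    FixesFirst m p.vertical}

/-- The cardinality of `isolatedSet lam m k`. -/
noncomputable def isolatedCount {n : ℕ} (lam : n.Partition) (m k : ℕ) : ℕ :=
  (isolatedSet lam m k).ncard

/-- The number of permutations of `[n]` with `k` cycles having all the elements of `[m]` as
fixed points. -/
noncomputable def cHat (m n k : ℕ) : ℕ :=
  {σ : Perm (Fin n) | numCycles σ = k ∧ FixesFirst m σ}.ncard

end PlanePermutation

namespace PlanePermutation

open Equiv

/-! The proof double-counts triples `(π, a, D)` on `n + 1` points, where `π` has `k` cycles and
fixes `[m]`, `D` fixes `a` and is an `n`-cycle on the other points, and `π * D` is an `(n +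
1)`-cycle.

Summing over `a` and `D` for fixed `π`: since `n - k` is even, `π` is odd, and every odd permutation
of `n + 1` points admits exactly `2 (n - 1)!` pairs `(a, D)` (`sum_offCount_of_sign_eq_neg_one`).
The total is `2 (n - 1)!` times `cHat m (n + 1) k`.

For fixed `a`, `π` must move `a`, as otherwise `π * D` fixes `a`; so `a` lies outside `[m]`, which
leaves `n + 1 - m` choices. Bypassing `a` in its cycle turns `π` into a permutation `σ` of `n`
points with the same number of cycles, `D` into a full cycle, and `π * D` into a full cycle.
Conversely, `π` is recovered from `σ` and the image of `a`, one of the `n - m` points outside `[m]`.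
So each such `a` contributes `n - m` times the required count (`sum_offCount_eq_mul_isolatedCount`).

The Stirling formula follows from the recurrence obtained by deleting the last point. -/

/-- The number of cycles of a permutation, fixed points included, as the number of orbits. -/
noncomputable def cycleCount {α : Type*} (σ : Perm α) : ℕ :=
  Nat.card (Quotient (Perm.SameCycle.setoid σ))

/-- `σ` has a single cycle, which contains every element. -/
def FullCycle {α : Type*} (σ : Perm α) : Prop :=
  ∀ x y, σ.SameCycle x y

/-- `σ` fixes `a` and permutes all other elements in a single cycle. -/
def FullCycleOff {α : Type*} (a : α) (σ : Perm α) : Prop :=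
  σ a = a ∧ ∀ x y, x ≠ a → y ≠ a → σ.SameCycle x y

/-! ### Invariance under relabelling. -/

section Transport

variable {α β : Type*}

theorem permCongr_zpow_apply (e : α ≃ β) (σ : Perm α) (i : ℤ) (x : α) :
    (e.permCongr σ ^ i) (e x) = e ((σ ^ i) x) := by
  have h : e.permCongr σ ^ i = e.permCongr (σ ^ i) := (map_zpow e.permCongrHom σ i).symm
  rw [h]
  simp

theorem sameCycle_permCongr (e : α ≃ β) (σ : Perm α) (x y : α) :
    (e.permCongr σ).SameCycle (e x) (e y) ↔ σ.SameCycle x y := by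
  unfold Perm.SameCycle
  simp only [permCongr_zpow_apply, e.apply_eq_iff_eq]

theorem fullCycle_permCongr (e : α ≃ β) (σ : Perm α) :
    FullCycle (e.permCongr σ) ↔ FullCycle σ := by
  unfold FullCycle
  simp only [e.surjective.forall, sameCycle_permCongr]

theorem fullCycleOff_permCongr (e : α ≃ β) (a : α) (σ : Perm α) :
    FullCycleOff (e a) (e.permCongr σ) ↔ FullCycleOff a σ := by
  unfold FullCycleOff
  simp only [e.surjective.forall, sameCycle_permCongr, ne_eq, e.apply_eq_iff_eq,
    permCongr_apply, symm_apply_apply]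

theorem cycleCount_permCongr (e : α ≃ β) (σ : Perm α) :
    cycleCount (e.permCongr σ) = cycleCount σ :=
  (Nat.card_congr (Quotient.congr e fun x y => (sameCycle_permCongr e σ x y).symm)).symm

/-- Conjugating `σ * τ` by `τ` gives `τ * σ`. -/
theorem fullCycle_mul_comm (σ τ : Perm α) : FullCycle (σ * τ) ↔ FullCycle (τ * σ) := by
  rw [← fullCycle_permCongr τ (σ * τ)]
  have h : τ.permCongr (σ * τ) = τ * σ := by
    ext x
    simp [Perm.mul_apply]
  rw [h]

end Transport

/-! ### Bypassing a point in its cycle. -/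

section Bypass

variable {α : Type*} [DecidableEq α]

/-- Bypassing `a` in its cycle does not change the cycle relation among the other elements. -/
theorem sameCycle_swap_mul [Finite α] (τ : Perm α) (a : α) {x y : α} (hx : x ≠ a) (hy : y ≠ a) :
    (swap a (τ a) * τ).SameCycle x y ↔ τ.SameCycle x y := by
  have hstep : ∀ z, (τ z ≠ a → (swap a (τ a) * τ) z = τ z ∨ z = a) ∧
      (τ z = a → (swap a (τ a) * τ) z = τ a) := by
    intro z
    refine ⟨fun h => ?_, fun h => by simp [h]⟩
    by_cases hz : z = a
    · exact Or.inr hz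
    · left
      rw [Perm.mul_apply, swap_apply_of_ne_of_ne h (τ.injective.ne hz)]
  constructor
  · intro h
    obtain ⟨n, rfl⟩ := h.exists_nat_pow_eq
    clear hy h
    induction n with
    | zero => exact Perm.SameCycle.refl _ _
    | succ n ih =>
      rw [pow_succ', Perm.mul_apply]
      refine ih.trans ?_
      generalize ((swap a (τ a) * τ) ^ n) x = z
      by_cases h1 : τ z = a
      · rw [(hstep z).2 h1, ← h1]
        exact (Perm.sameCycle_apply_right.2 (Perm.sameCycle_apply_right.2 (Perm.SameCycle.refl _ _)))
      · rcases (hstep z).1 h1 with h2 | rfl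
        · rw [h2]
          exact Perm.sameCycle_apply_right.2 (Perm.SameCycle.refl _ _)
        · simp
          exact Perm.SameCycle.refl _ _
  -- Induction on the number of `τ`-steps from `x` to `y`: one new step replaces one old step, or
  -- two when the old path runs through `a`.
  · intro h
    obtain ⟨n, hn⟩ := h.exists_nat_pow_eq
    clear h
    induction n using Nat.strong_induction_on generalizing x with
    | _ n ih =>
      obtain _ | n := n
      · rw [show x = y from hn]
      by_cases h1 : τ x = a
      · obtain _ | n := n
        · exact absurd (by simpa [h1] using hn.symm) hy
        · rw [← Perm.sameCycle_apply_left, (hstep x).2 h1]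
          refine ih n (by omega) (fun h2 => hx (τ.injective (h1.trans h2.symm))) ?_
          rw [← hn, pow_succ, pow_succ, Perm.mul_apply, Perm.mul_apply, h1]
      · rw [← Perm.sameCycle_apply_left, ((hstep x).1 h1).resolve_right hx]
        refine ih n (by omega) h1 ?_
        rw [← hn, pow_succ, Perm.mul_apply]

end Bypass

/-! ### Inserting a point into a permutation. -/

section OptionPerm

variable {α : Type*}

theorem optionCongr_zpow_some (σ : Perm α) (i : ℤ) (x : α) :
    ((optionCongr σ : Perm (Option α)) ^ i) (some x) = some ((σ ^ i) x) := by
  have key : ∀ (τ : Perm α) (n : ℕ) (x : α),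
      ((optionCongr τ : Perm (Option α)) ^ n) (some x) = some ((τ ^ n) x) := by
    intro τ n
    induction n with
    | zero => intro x; rfl
    | succ n ih => intro x; rw [pow_succ, pow_succ, Perm.mul_apply, Perm.mul_apply, ← ih]; simp
  cases i with
  | ofNat n => simpa using key σ n x
  | negSucc n =>
    rw [zpow_negSucc, zpow_negSucc, ← inv_pow, ← inv_pow]
    exact key σ⁻¹ (n + 1) x

theorem sameCycle_optionCongr (σ : Perm α) (x y : α) :
    Perm.SameCycle (optionCongr σ : Perm (Option α)) (some x) (some y) ↔ σ.SameCycle x y := by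
  unfold Perm.SameCycle
  simp only [optionCongr_zpow_some, Option.some_inj]

variable [DecidableEq α]

/-- The permutation of `Option α` which takes `none` to `z` and becomes `σ` when `none` is
bypassed. -/
def insertNone (z : Option α) (σ : Perm α) : Perm (Option α) :=
  swap none z * optionCongr σ

@[simp]
theorem insertNone_none (z : Option α) (σ : Perm α) : insertNone z σ none = z := by
  simp [insertNone]

theorem sum_perm_option {M : Type*} [AddCommMonoid M] [Fintype α] (φ : Perm (Option α) → M) :
    ∑ τ, φ τ = ∑ z : Option α, ∑ σ : Perm α, φ (insertNone z σ) := by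
  rw [← Fintype.sum_prod_type' (f := fun z σ => φ (insertNone z σ))]
  exact (Fintype.sum_equiv Perm.decomposeOption.symm _ _ fun p => rfl).symm

theorem exists_eq_insertNone (τ : Perm (Option α)) : ∃ σ, τ = insertNone (τ none) σ := by
  obtain ⟨⟨z, σ⟩, rfl⟩ := Perm.decomposeOption.symm.surjective τ
  exact ⟨σ, by simp [insertNone]⟩

theorem sign_insertNone_some [Fintype α] (z : α) (σ : Perm α) :
    Perm.sign (insertNone (some z) σ) = -Perm.sign σ := by
  rw [insertNone, Perm.sign_mul, Perm.sign_swap (by simp), optionCongr_sign]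
  simp

theorem sameCycle_insertNone [Finite α] (z : Option α) (σ : Perm α) (x y : α) :
    (insertNone z σ).SameCycle (some x) (some y) ↔ σ.SameCycle x y := by
  rw [← sameCycle_swap_mul _ none (by simp) (by simp), insertNone_none, insertNone,
    swap_mul_self_mul, sameCycle_optionCongr]

theorem sameCycle_insertNone_none (z : α) (σ : Perm α) :
    (insertNone (some z) σ).SameCycle none (some z) := by
  have h := Perm.sameCycle_apply_right.2 (Perm.SameCycle.refl (insertNone (some z) σ) none)
  rwa [insertNone_none] at h

theorem fullCycle_insertNone_some [Finite α] (z : α) (σ : Perm α) :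
    FullCycle (insertNone (some z) σ) ↔ FullCycle σ := by
  refine ⟨fun h x y => (sameCycle_insertNone (some z) σ x y).1 (h _ _), fun h => ?_⟩
  have hz : ∀ x, (insertNone (some z) σ).SameCycle (some z) x := by
    rintro (_ | x)
    · exact (sameCycle_insertNone_none z σ).symm
    · exact (sameCycle_insertNone _ σ z x).2 (h _ _)
  exact fun x y => (hz x).symm.trans (hz y)

theorem not_fullCycle_of_fixed {α : Type*} [Nontrivial α] {σ : Perm α} {a : α} (h : σ a = a) :
    ¬ FullCycle σ := by
  obtain ⟨b, hb⟩ := exists_ne a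
  exact fun hσ => hb ((hσ a b).eq_of_left h).symm

theorem fullCycleOff_none_insertNone [Finite α] (z : Option α) (σ : Perm α) :
    FullCycleOff none (insertNone z σ) ↔ z = none ∧ FullCycle σ := by
  unfold FullCycleOff FullCycle
  rw [insertNone_none]
  refine and_congr_right fun _ => ⟨fun h x y => ?_, fun h => ?_⟩
  · exact (sameCycle_insertNone z σ x y).1 (h _ _ (by simp) (by simp))
  · rintro (_ | x) (_ | y) hx hy
    · exact absurd rfl hx
    · exact absurd rfl hx
    · exact absurd rfl hy
    · exact (sameCycle_insertNone z σ x y).2 (h _ _)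

theorem insertNone_some_eq_iff (z : Option α) (σ : Perm α) (x : α) :
    insertNone z σ (some x) = some x ↔ z ≠ some x ∧ σ x = x := by
  by_cases h : z = some (σ x)
  · subst h
    simp only [insertNone, Perm.mul_apply, optionCongr_apply, Option.map_some, swap_apply_right]
    simp
  · have : insertNone z σ (some x) = some (σ x) := by
      simp only [insertNone, Perm.mul_apply, optionCongr_apply, Option.map_some]
      exact swap_apply_of_ne_of_ne (by simp) (fun h' => h h'.symm)
    rw [this, Option.some_inj]
    refine ⟨fun h' => ⟨fun h'' => h (by rw [h', h'']), h'⟩, fun h' => h'.2⟩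

theorem fullCycleOff_some_insertNone [Finite α] [Nontrivial α] (c : α) (z : Option α)
    (σ : Perm α) :
    FullCycleOff (some c) (insertNone z σ) ↔ z ≠ none ∧ z ≠ some c ∧ FullCycleOff c σ := by
  constructor
  · rintro ⟨h1, h2⟩
    obtain ⟨h3, h4⟩ := (insertNone_some_eq_iff z σ c).1 h1
    refine ⟨?_, h3, h4, fun x y hx hy =>
      (sameCycle_insertNone z σ x y).1 (h2 _ _ (by simpa using hx) (by simpa using hy))⟩
    -- Otherwise `none` would be a second fixed point, although a point other than `c` should share
    -- its cycle.
    rintro rfl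
    obtain ⟨y, hy⟩ := exists_ne c
    have := (h2 none (some y) (by simp) (by simpa using hy)).eq_of_left (insertNone_none _ _)
    simp at this
  · rintro ⟨h1, h2, h3, h4⟩
    obtain ⟨b, rfl⟩ := Option.ne_none_iff_exists'.1 h1
    have hb : b ≠ c := by simpa using h2
    refine ⟨(insertNone_some_eq_iff _ σ c).2 ⟨h2, h3⟩, ?_⟩
    have hz : ∀ x, x ≠ some c → (insertNone (some b) σ).SameCycle (some b) x := by
      rintro (_ | x) hx
      · exact (sameCycle_insertNone_none b σ).symm
      · exact (sameCycle_insertNone _ σ b x).2 (h4 _ _ hb (by simpa using hx))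
    exact fun x y hx hy => (hz x hx).symm.trans (hz y hy)

/-- Inserting `b` right before `x` in the long cycle of a permutation fixing `b`. -/
theorem fullCycle_swap_mul {α : Type*} [DecidableEq α] [Finite α] {x b : α} (hxb : b ≠ x)
    (σ : Perm α) :
    (FullCycle (swap x b * σ) ∧ (swap x b * σ) b = x) ↔ FullCycleOff b σ := by
  have hb : (swap x b * σ) b = x ↔ σ b = b := by
    rw [Perm.mul_apply, swap_apply_eq_iff, swap_apply_left]
  rw [and_comm, hb]
  refine and_congr_right fun h => ?_
  have h1 : swap b ((swap x b * σ) b) * (swap x b * σ) = σ := by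
    rw [hb.2 h, swap_comm b x, swap_mul_self_mul]
  have key : ∀ y z, y ≠ b → z ≠ b → ((swap x b * σ).SameCycle y z ↔ σ.SameCycle y z) := by
    intro y z hy hz
    rw [← sameCycle_swap_mul (swap x b * σ) b hy hz, h1]
  refine ⟨fun H y z hy hz => (key y z hy hz).1 (H y z), fun H => ?_⟩
  have hz : ∀ y, (swap x b * σ).SameCycle x y := by
    intro y
    by_cases hy : y = b
    · subst hy
      have := Perm.sameCycle_apply_right.2 (Perm.SameCycle.refl (swap x y * σ) y)
      rw [hb.2 h] at this
      exact this.symm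
    · exact (key x y hxb.symm hy).2 (H _ _ hxb.symm hy)
  exact fun y z => (hz y).symm.trans (hz z)

end OptionPerm

/-! ### Recursion for factorizations of a permutation. -/

section Counts

open Classical in
/-- The number of full cycles `D` such that `π * D` is a full cycle. -/
noncomputable def pairCount {α : Type*} [Fintype α] [DecidableEq α] (π : Perm α) : ℕ :=
  ∑ D : Perm α, if FullCycle D ∧ FullCycle (π * D) then 1 else 0

open Classical in
/-- The number of cycles `D` moving exactly the elements other than `a` such that `π * D` is a
full cycle. -/
noncomputable def offCount {α : Type*} [Fintype α] [DecidableEq α] (a : α) (π : Perm α) : ℕ :=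
  ∑ D : Perm α, if FullCycleOff a D ∧ FullCycle (π * D) then 1 else 0

theorem offCount_permCongr {α β : Type*} [Fintype α] [Fintype β] [DecidableEq α]
    [DecidableEq β] (e : α ≃ β) (a : α)
    (π : Perm α) : offCount (e a) (e.permCongr π) = offCount a π := by
  classical
  unfold offCount
  refine (Fintype.sum_equiv e.permCongr _ _ fun D => ?_).symm
  have h : e.permCongr π * e.permCongr D = e.permCongr (π * D) :=
    (map_mul e.permCongrHom π D).symm
  rw [h, fullCycleOff_permCongr, fullCycle_permCongr]

theorem offCount_eq_zero {α : Type*} [Fintype α] [DecidableEq α] [Nontrivial α] {a : α} {π : Perm α}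
    (h : π a = a) : offCount a π = 0 := by
  classical
  refine Finset.sum_eq_zero fun D _ => if_neg ?_
  rintro ⟨h1, h2⟩
  exact not_fullCycle_of_fixed (a := a) (by rw [Perm.mul_apply, h1.1, h]) h2

theorem optionCongr_mul {β : Type*} (σ τ : Perm β) :
    (optionCongr (σ * τ) : Perm (Option β)) = optionCongr σ * optionCongr τ := by
  ext x; simp [Perm.mul_apply]

variable {β : Type*} [DecidableEq β]

theorem optionCongr_mul_swap_none (σ : Perm β) (x : β) :
    (optionCongr σ : Perm (Option β)) * swap none (some x) =
      swap none (some (σ x)) * optionCongr σ := by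
  rw [mul_swap_eq_swap_mul]
  simp

theorem insertNone_mul_insertNone_none (z : Option β) (σ τ : Perm β) :
    insertNone z σ * insertNone none τ = insertNone z (σ * τ) := by
  simp only [insertNone, optionCongr_mul, mul_assoc, swap_self]
  rfl

/-- Writing the image of `none` as `σ x` lets the transposition pass to the right of `σ`, where
`(none x)(none b) = (none b)(x b)`. -/
theorem insertNone_mul_insertNone_some (σ τ : Perm β) {x b : β} (hb : b ≠ x) :
    insertNone (some (σ x)) σ * insertNone (some b) τ =
      insertNone (some (σ b)) (σ * swap x b * τ) := by
  have h : swap (none : Option β) (some x) * swap none (some b) =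
      swap none (some b) * optionCongr (swap x b) := by
    rw [optionCongr_swap, mul_swap_eq_swap_mul (swap none (some x)), swap_apply_left,
      swap_apply_of_ne_of_ne (by simp) (by simpa using hb),
      mul_swap_eq_swap_mul (swap (some x) (some b)), swap_apply_left,
      swap_apply_of_ne_of_ne (by simp) (by simp)]
  rw [insertNone, insertNone, insertNone, ← optionCongr_mul_swap_none, mul_assoc,
    ← mul_assoc (swap _ _) (swap _ _), h, ← mul_assoc, ← mul_assoc, optionCongr_mul_swap_none,
    optionCongr_mul, optionCongr_mul]
  simp only [mul_assoc]

variable [Fintype β]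

theorem offCount_none_insertNone (z : β) (σ : Perm β) :
    offCount none (insertNone (some z) σ) = pairCount σ := by
  classical
  unfold offCount pairCount
  rw [sum_perm_option, Fintype.sum_option]
  simp only [fullCycleOff_none_insertNone, insertNone_mul_insertNone_none,
    fullCycle_insertNone_some]
  simp

theorem offCount_some_insertNone [Nontrivial β] (c x : β) (σ : Perm β) :
    offCount (some c) (insertNone (some (σ x)) σ) =
      ∑ b : β, if b ≠ x then (if b ≠ c then offCount c (σ * swap x b) else 0) else 0 := by
  classical
  unfold offCount
  rw [sum_perm_option, Fintype.sum_option]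
  simp only [fullCycleOff_some_insertNone, ne_eq, not_true_eq_false, false_and, if_false,
    Finset.sum_const_zero, zero_add]
  refine Fintype.sum_congr _ _ fun b => ?_
  by_cases h1 : b = x
  · rw [if_neg (not_not.2 h1)]
    refine Finset.sum_eq_zero fun D _ => if_neg ?_
    rintro ⟨-, h⟩
    refine not_fullCycle_of_fixed (a := none) ?_ h
    rw [Perm.mul_apply, insertNone_none, h1, insertNone]
    simp
  rw [if_pos h1]
  by_cases h2 : b = c
  · simp [h2]
  · rw [if_pos h2]
    refine Fintype.sum_congr _ _ fun D => ?_
    rw [insertNone_mul_insertNone_some σ D h1, fullCycle_insertNone_some]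
    simp [h2]

theorem pairCount_eq_sum_offCount [Nontrivial β] (x : β) (σ : Perm β) :
    pairCount σ = ∑ b : β, if b ≠ x then offCount b (σ * swap x b) else 0 := by
  classical
  -- Full cycles `D` are sorted by the preimage `b` of `x`; cutting `b` out of `D` leaves a cycle
  -- fixing `b`.
  have h1 : pairCount σ = ∑ b : β, ∑ D : Perm β,
      if (FullCycle D ∧ FullCycle (σ * D)) ∧ D b = x then 1 else 0 := by
    rw [Finset.sum_comm]
    refine Fintype.sum_congr _ _ fun D => ?_
    simp only [ite_and, ← Equiv.eq_symm_apply D]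
    split_ifs <;> simp
  rw [h1]
  refine Fintype.sum_congr _ _ fun b => ?_
  split_ifs with hb
  · unfold offCount
    refine (Fintype.sum_equiv (Equiv.mulLeft (swap x b)) _ _ fun D => ?_).symm
    refine if_congr ?_ rfl rfl
    rw [Equiv.coe_mulLeft, ← fullCycle_swap_mul hb D, mul_assoc]
    tauto
  · refine Finset.sum_eq_zero fun D _ => if_neg ?_
    rintro ⟨h, h'⟩
    rw [not_not.1 hb] at h'
    exact not_fullCycle_of_fixed h' h.1

/-- For `a = some c`, the term `b = c` is missing from the expansion. The case `a = none`, expanded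
over `b`, supplies exactly these diagonal terms. -/
theorem sum_offCount_insertNone [Nontrivial β] (x : β) (σ : Perm β) :
    ∑ a, offCount a (insertNone (some (σ x)) σ) =
      ∑ b : β, if b ≠ x then ∑ a, offCount a (σ * swap x b) else 0 := by
  classical
  rw [Fintype.sum_option, offCount_none_insertNone, pairCount_eq_sum_offCount x]
  simp only [offCount_some_insertNone]
  rw [Finset.sum_comm, ← Finset.sum_add_distrib]
  refine Finset.sum_congr rfl fun b _ => ?_
  split_ifs with h
  · rw [← Finset.sum_filter, Finset.filter_ne, add_comm]
    exact Finset.sum_erase_add _ _ (Finset.mem_univ b)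
  · simp

end Counts

/-! ### Counting the factorizations of an odd permutation. -/

theorem sum_offCount_permCongr {α β : Type*} [Fintype α] [Fintype β] [DecidableEq α]
    [DecidableEq β] (e : α ≃ β) (π : Perm α) :
    ∑ a, offCount a (e.permCongr π) = ∑ a, offCount a π :=
  (Fintype.sum_equiv e _ _ fun a => (offCount_permCongr e a π).symm).symm

/-- Every odd permutation of `N ≥ 2` elements has exactly `2 (N - 2)!` factorizations into an
`N`-cycle and an `(N - 1)`-cycle. -/
theorem sum_offCount_of_sign_eq_neg_one (N : ℕ) {α : Type*} [Fintype α] [DecidableEq α]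
    (hα : Fintype.card α = N + 2) (π : Perm α) (hπ : Perm.sign π = -1) :
    ∑ a, offCount a π = 2 * N.factorial := by
  induction N generalizing α with
  | zero =>
    classical
    have hne : π ≠ 1 := by rintro rfl; simp at hπ
    have hcard : Fintype.card (Perm α) = 2 := by rw [Fintype.card_perm, hα]; rfl
    have hD : ∀ D : Perm α, D = 1 ∨ D = π := by
      intro D
      by_contra! h
      have := Finset.card_le_univ ({D, 1, π} : Finset (Perm α))
      rw [Finset.card_eq_three.2 ⟨D, 1, π, h.1, h.2, hne.symm, rfl⟩, hcard] at this
      omega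
    have hnt : Nontrivial α := Fintype.one_lt_card_iff_nontrivial.1 (by omega)
    have hfix : ∀ a, π a ≠ a := by
      intro a ha
      refine hne (Equiv.ext fun b => ?_)
      by_contra hb
      have hb' : π b ≠ b := hb
      have h1 : b ≠ a := by rintro rfl; exact hb' ha
      have h2 : π b ≠ a := fun h => h1 (π.injective (h.trans ha.symm))
      have := Finset.card_le_univ ({π b, b, a} : Finset α)
      rw [Finset.card_eq_three.2 ⟨π b, b, a, hb', h2, h1, rfl⟩, hα] at this
      omega
    have htwo : ∀ a b c : α, b ≠ a → c ≠ a → b = c := by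
      intro a b c hb hc
      by_contra h
      have := Finset.card_le_univ ({b, c, a} : Finset α)
      rw [Finset.card_eq_three.2 ⟨b, c, a, h, hb, hc, rfl⟩, hα] at this
      omega
    have hfull : FullCycle π := by
      intro a b
      by_cases h : b = a
      · rw [h]
      · rw [htwo a b (π a) h (hfix a)]
        exact Perm.sameCycle_apply_right.2 (Perm.SameCycle.refl _ _)
    -- On two points `π` is the transposition, and only `D = 1` fixes `a`.
    have hone : ∀ a, offCount a π = 1 := by
      intro a
      unfold offCount
      rw [Finset.sum_eq_single 1]
      · rw [if_pos]
        refine ⟨⟨rfl, fun x y hx hy => ?_⟩, by simpa using hfull⟩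
        rw [htwo a x y hx hy]
      · intro D _ hD1
        rw [if_neg]
        rintro ⟨h, -⟩
        rw [(hD D).resolve_left hD1] at h
        exact hfix a h.1
      · simp
    simp [hone, hα]
  | succ N ih =>
    have hne : π ≠ 1 := by rintro rfl; simp at hπ
    obtain ⟨a, ha⟩ : ∃ a, π a ≠ a := by
      by_contra! h
      exact hne (Equiv.ext h)
    let e : α ≃ Option {b // b ≠ a} := (optionSubtypeNe a).symm
    rw [← sum_offCount_permCongr e]
    obtain ⟨σ, hσ⟩ := exists_eq_insertNone (e.permCongr π)
    have hz : e.permCongr π none ≠ none := by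
      simp only [e, permCongr_apply, symm_symm, optionSubtypeNe_none]
      rw [optionSubtypeNe_symm_of_ne ha]
      simp
    obtain ⟨z, hz⟩ := Option.ne_none_iff_exists'.1 hz
    rw [hz] at hσ
    have hsign : Perm.sign σ = 1 := by
      have h := Perm.sign_permCongr e π
      rw [hσ, sign_insertNone_some, hπ] at h
      simpa using h
    have hcard : Fintype.card {b // b ≠ a} = N + 2 := by
      have := Fintype.card_congr e
      rw [hα, Fintype.card_option] at this
      omega
    have hnt : Nontrivial {b // b ≠ a} := Fintype.one_lt_card_iff_nontrivial.1 (by omega)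
    obtain ⟨x, rfl⟩ := σ.surjective z
    rw [hσ, sum_offCount_insertNone]
    -- Removing a moved point makes `σ` even, so each `σ * swap x b` is odd again; the `N + 1`
    -- choices of `b` supply the new factor of the factorial.
    have : ∀ b : {b // b ≠ a}, (if b ≠ x then ∑ c, offCount c (σ * swap x b) else 0) =
        if b ≠ x then 2 * N.factorial else 0 := by
      intro b
      split_ifs with hb
      · rw [ih hcard]
        rw [Perm.sign_mul, hsign, Perm.sign_swap hb.symm, one_mul]
      · rfl
    rw [Finset.sum_congr rfl fun b _ => this b, ← Finset.sum_filter, Finset.sum_const,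
      Finset.filter_ne', Finset.card_erase_of_mem (Finset.mem_univ x), Finset.card_univ, hcard,
      Nat.factorial_succ, smul_eq_mul]
    simp only [Nat.add_succ_sub_one]
    ring

/-! ### Cycle numbers and parity. -/

section CycleCount

variable {α : Type*}

theorem cycleCount_insertNone_some [DecidableEq α] [Finite α] (z : α) (σ : Perm α) :
    cycleCount (insertNone (some z) σ) = cycleCount σ := by
  refine (Nat.card_congr (Equiv.ofBijective
    (Quotient.map' some fun x y h => (sameCycle_insertNone (some z) σ x y).2 h) ⟨?_, ?_⟩)).symm
  · rintro ⟨x⟩ ⟨y⟩ h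
    exact Quotient.sound ((sameCycle_insertNone (some z) σ x y).1 (Quotient.exact h))
  · rintro ⟨_ | x⟩
    · exact ⟨Quotient.mk _ z, Quotient.sound (sameCycle_insertNone_none z σ).symm⟩
    · exact ⟨Quotient.mk _ x, rfl⟩

theorem cycleCount_insertNone_none [DecidableEq α] [Finite α] (σ : Perm α) :
    cycleCount (insertNone none σ) = cycleCount σ + 1 := by
  unfold cycleCount
  rw [← Finite.card_option]
  let F : Option (Quotient (Perm.SameCycle.setoid σ)) →
      Quotient (Perm.SameCycle.setoid (insertNone none σ)) := fun o =>
    o.elim (Quotient.mk _ none)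
      (Quotient.map' some fun x y h => (sameCycle_insertNone none σ x y).2 h)
  have hn : ∀ x, ¬ (insertNone none σ).SameCycle none (some x) := fun x h => by
    simpa using h.eq_of_left (insertNone_none none σ)
  refine (Nat.card_congr (Equiv.ofBijective F ⟨?_, ?_⟩)).symm
  · rintro (_ | x) (_ | y) h
    · rfl
    · induction y using Quotient.inductionOn
      exact absurd (Quotient.exact h) (hn _)
    · induction x using Quotient.inductionOn
      exact absurd (Quotient.exact h.symm) (hn _)
    · induction x using Quotient.inductionOn
      induction y using Quotient.inductionOn
      exact congrArg some
        (Quotient.sound ((sameCycle_insertNone none σ _ _).1 (Quotient.exact h)))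
  · rintro ⟨_ | x⟩
    · exact ⟨none, rfl⟩
    · exact ⟨some (Quotient.mk _ x), rfl⟩

theorem cycleCount_eq_card_cycleType [Fintype α] [DecidableEq α] (σ : Perm α) :
    cycleCount σ = σ.cycleType.card + (Fintype.card α - σ.support.card) := by
  -- The fibres of `F` are the orbits of `σ`.
  let F : α → σ.cycleFactorsFinset ⊕ {x // σ x = x} := fun x =>
    if h : σ x = x then Sum.inr ⟨x, h⟩
    else Sum.inl ⟨σ.cycleOf x,
      Perm.cycleOf_mem_cycleFactorsFinset_iff.2 (Perm.mem_support.2 h)⟩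
  have hF : ∀ x y, σ.SameCycle x y ↔ F x = F y := by
    intro x y
    by_cases hx : σ x = x <;> by_cases hy : σ y = y
    · simp only [F, dif_pos hx, dif_pos hy, Sum.inr.injEq, Subtype.mk.injEq]
      exact ⟨fun h => h.eq_of_left hx, fun h => h ▸ Perm.SameCycle.refl _ _⟩
    · simp only [F, dif_pos hx, dif_neg hy, reduceCtorEq, iff_false]
      exact fun h => hy (h.apply_eq_self_iff.1 hx)
    · simp only [F, dif_neg hx, dif_pos hy, reduceCtorEq, iff_false]
      exact fun h => hx (h.apply_eq_self_iff.2 hy)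
    · simp only [F, dif_neg hx, dif_neg hy, Sum.inl.injEq, Subtype.mk.injEq]
      exact Perm.sameCycle_iff_cycleOf_eq_of_mem_support (Perm.mem_support.2 hx)
        (Perm.mem_support.2 hy)
  have hsurj : Function.Surjective F := by
    rintro (⟨c, hc⟩ | ⟨x, hx⟩)
    · obtain ⟨x, hx⟩ := (Perm.mem_cycleFactorsFinset_iff.1 hc).1.nonempty_support
      have hcx := Perm.cycle_is_cycleOf hx hc
      have hσ : σ x ≠ x :=
        Perm.mem_support.1 (Perm.mem_cycleFactorsFinset_support_le hc hx)
      exact ⟨x, by simp only [F, dif_neg hσ, hcx]⟩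
    · exact ⟨x, by simp only [F, dif_pos hx]⟩
  have h1 : cycleCount σ = Nat.card (σ.cycleFactorsFinset ⊕ {x // σ x = x}) := by
    refine Nat.card_congr (Equiv.ofBijective (Quotient.lift F fun x y h => (hF x y).1 h) ⟨?_, ?_⟩)
    · rintro ⟨x⟩ ⟨y⟩ h
      exact Quotient.sound ((hF x y).2 h)
    · intro c
      obtain ⟨x, rfl⟩ := hsurj c
      exact ⟨Quotient.mk _ x, rfl⟩
  rw [h1, Nat.card_sum, Nat.card_eq_fintype_card, Nat.card_eq_fintype_card, Fintype.card_coe,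
    Perm.cycleType_def, Multiset.card_map, Finset.card_val]
  congr 1
  rw [Fintype.card_subtype, ← Finset.card_compl]
  congr 1
  ext x
  simp

theorem sign_eq_neg_one_pow_cycleCount [Fintype α] [DecidableEq α] (σ : Perm α) :
    Perm.sign σ = (-1) ^ (Fintype.card α + cycleCount σ) := by
  have h := σ.support.card_le_univ
  rw [Perm.sign_of_cycleType, Perm.sum_cycleType, cycleCount_eq_card_cycleType]
  rw [show Fintype.card α + (σ.cycleType.card + (Fintype.card α - σ.support.card)) =
    σ.support.card + σ.cycleType.card + 2 * (Fintype.card α - σ.support.card) by omega,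
    pow_add _ _ (2 * _), pow_mul]
  simp

theorem fullCycle_iff_cycleCount_eq_one [Finite α] [Nonempty α] (σ : Perm α) :
    FullCycle σ ↔ cycleCount σ = 1 := by
  unfold cycleCount
  rw [Nat.card_eq_one_iff_unique]
  constructor
  · refine fun h => ⟨⟨?_⟩, Nonempty.map (Quotient.mk _) ‹_›⟩
    rintro ⟨x⟩ ⟨y⟩
    exact Quotient.sound (h x y)
  · exact fun h x y => Quotient.exact (h.1.elim (Quotient.mk _ x) (Quotient.mk _ y))

end CycleCount

theorem numCycles_eq_cycleCount {n : ℕ} (σ : Perm (Fin n)) : numCycles σ = cycleCount σ := by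
  rw [cycleCount_eq_card_cycleType]
  simp [numCycles, cycleTypePartition, Perm.parts_partition]

theorem isLongCycle_iff_fullCycle {n : ℕ} (hn : n ≠ 0) (σ : Perm (Fin n)) :
    IsLongCycle σ ↔ FullCycle σ := by
  have : NeZero n := ⟨hn⟩
  rw [fullCycle_iff_cycleCount_eq_one, ← numCycles_eq_cycleCount, IsLongCycle, numCycles,
    Nat.Partition.ext_iff, Nat.Partition.indiscrete_parts hn, Multiset.card_eq_one]
  refine ⟨fun h => ⟨n, h⟩, ?_⟩
  rintro ⟨a, ha⟩
  have h := (cycleTypePartition σ).parts_sum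
  rw [ha, Multiset.sum_singleton] at h
  rw [ha, h]

/-! ### Deleting a point while keeping `[m]` fixed. -/

section FixesFirst

variable {n : ℕ}

/-- Deleting a point `a ≥ m` shifts only labels above `a`, so `[m]` keeps its labels. -/
theorem fixesFirst_permCongr {m : ℕ} {a : Fin (n + 1)} (ha : m ≤ a) (τ : Perm (Option (Fin n))) :
    FixesFirst m ((finSuccEquiv' a).symm.permCongr τ) ↔
      ∀ i : Fin n, (i : ℕ) < m → τ (some i) = some i := by
  have hval : ∀ i : Fin n, (a.succAbove i : ℕ) < m ↔ (i : ℕ) < m := by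
    intro i
    rcases lt_or_ge (i : ℕ) a with h | h
    · rw [Fin.succAbove_of_castSucc_lt _ _ (by simpa [Fin.lt_def] using h)]
      simp
    · rw [Fin.succAbove_of_le_castSucc _ _ (by simpa [Fin.le_def] using h)]
      simp only [Fin.val_succ]
      omega
  have hfix : ∀ i : Fin n, (finSuccEquiv' a).symm.permCongr τ (a.succAbove i) = a.succAbove i ↔
      τ (some i) = some i := by
    intro i
    rw [permCongr_apply, symm_symm, finSuccEquiv'_succAbove, symm_apply_eq,
      finSuccEquiv'_succAbove]
  constructor
  · exact fun h i hi => (hfix i).1 (h _ ((hval i).2 hi))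
  · intro h i hi
    obtain ⟨j, rfl⟩ := Fin.exists_succAbove_eq (x := i) (y := a) (by rintro rfl; omega)
    exact (hfix j).2 (h j ((hval j).1 hi))

theorem fixesFirst_insertNone_none {m : ℕ} {a : Fin (n + 1)} (ha : m ≤ a) (σ : Perm (Fin n)) :
    FixesFirst m ((finSuccEquiv' a).symm.permCongr (insertNone none σ)) ↔ FixesFirst m σ := by
  rw [fixesFirst_permCongr ha]
  simp [insertNone_some_eq_iff, FixesFirst]

theorem fixesFirst_insertNone_some {m : ℕ} {a : Fin (n + 1)} (ha : m ≤ a) (z : Fin n)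
    (σ : Perm (Fin n)) :
    FixesFirst m ((finSuccEquiv' a).symm.permCongr (insertNone (some z) σ)) ↔
      m ≤ z ∧ FixesFirst m σ := by
  rw [fixesFirst_permCongr ha]
  simp only [insertNone_some_eq_iff, FixesFirst, ne_eq, Option.some_inj]
  constructor
  · exact fun h => ⟨by by_contra hz; exact (h z (by omega)).1 rfl, fun i hi => (h i hi).2⟩
  · exact fun h i hi => ⟨by rintro rfl; omega, h.2 i hi⟩

theorem numCycles_permCongr (a : Fin (n + 1)) (τ : Perm (Option (Fin n))) :
    numCycles ((finSuccEquiv' a).symm.permCongr τ) = cycleCount τ := by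
  rw [numCycles_eq_cycleCount, cycleCount_permCongr]

theorem sum_perm_fin_succ {M : Type*} [AddCommMonoid M] (a : Fin (n + 1))
    (φ : Perm (Fin (n + 1)) → M) :
    ∑ π, φ π = ∑ z : Option (Fin n), ∑ σ : Perm (Fin n),
      φ ((finSuccEquiv' a).symm.permCongr (insertNone z σ)) := by
  rw [← sum_perm_option (fun τ => φ ((finSuccEquiv' a).symm.permCongr τ))]
  exact (Fintype.sum_equiv (finSuccEquiv' a).symm.permCongr _ _ fun τ => rfl).symm

theorem sum_fin_ite_le (n m c : ℕ) : ∑ j : Fin n, (if m ≤ (j : ℕ) then c else 0) = (n - m) * c := by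
  rw [Fin.sum_univ_eq_sum_range (fun j => if m ≤ j then c else 0), ← Finset.sum_filter,
    Finset.sum_const, smul_eq_mul]
  congr 1
  have : (Finset.range n).filter (m ≤ ·) = Finset.Ico m n := by
    ext; simp; omega
  rw [this, Nat.card_Ico]

open Classical in
theorem cHat_eq_sum (m n k : ℕ) :
    cHat m n k = ∑ σ : Perm (Fin n), if numCycles σ = k ∧ FixesFirst m σ then 1 else 0 := by
  rw [cHat, Set.ncard_eq_toFinset_card', ← Finset.card_filter]
  congr 1
  ext
  simp

open Classical in
theorem isolatedCount_indiscrete_eq_sum (hn : n ≠ 0) (m k : ℕ) :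
    isolatedCount (Nat.Partition.indiscrete n) m k =
      ∑ π : Perm (Fin n), if numCycles π = k ∧ FixesFirst m π then pairCount π else 0 := by
  have h1 : ∀ π : Perm (Fin n), (if numCycles π = k ∧ FixesFirst m π then pairCount π else 0) =
      ∑ D : Perm (Fin n), if (numCycles π = k ∧ FixesFirst m π) ∧
        FullCycle D ∧ FullCycle (π * D) then 1 else 0 := by
    intro π
    unfold pairCount
    split_ifs with h <;> simp [h]
  simp only [h1]
  rw [← Fintype.sum_prod_type' (f := fun π D => if (numCycles π = k ∧ FixesFirst m π) ∧
    FullCycle D ∧ FullCycle (π * D) then 1 else 0), ← Finset.card_filter, ← Fintype.card_subtype,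
    ← Nat.card_eq_fintype_card]
  -- A plane permutation is determined by `π` and its diagonal `D`, with `s = D * π`; this is
  -- conjugate to the `π * D` of `pairCount`.
  refine Nat.card_congr
    { toFun := fun p => ⟨(p.1.vertical, p.1.diagonal), p.2.2,
        (isLongCycle_iff_fullCycle hn _).1 p.2.1, ?_⟩
      invFun := fun q => ⟨⟨q.1.2 * q.1.1, q.1.1, (isLongCycle_iff_fullCycle hn _).2
        ((fullCycle_mul_comm _ _).1 q.2.2.2)⟩,
        (isLongCycle_iff_fullCycle hn _).2 ?_, q.2.1⟩
      left_inv := ?_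
      right_inv := ?_ }
  · rw [fullCycle_mul_comm]
    simpa [PlanePerm.diagonal] using (isLongCycle_iff_fullCycle hn _).1 p.1.isLongCycle_upper
  · simpa [PlanePerm.diagonal] using q.2.2.1
  · intro p
    ext1
    ext1 <;> simp [PlanePerm.diagonal]
  · intro q
    ext1
    simp [PlanePerm.diagonal]

end FixesFirst

/-! ### The Stirling recurrence and the double count. -/

theorem cHat_succ {m n : ℕ} (hmn : m ≤ n) (k : ℕ) :
    cHat m (n + 1) (k + 1) = cHat m n k + (n - m) * cHat m n (k + 1) := by
  classical
  simp only [cHat_eq_sum]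
  rw [sum_perm_fin_succ (Fin.last n), Fintype.sum_option]
  have hl : m ≤ (Fin.last n : ℕ) := by simpa using hmn
  -- The last point is either a cycle by itself or is sent to some `z ≥ m`; an image in `[m]` would
  -- unfix that element.
  simp only [numCycles_permCongr, fixesFirst_insertNone_none hl, fixesFirst_insertNone_some hl,
    cycleCount_insertNone_none, cycleCount_insertNone_some, add_left_inj,
    ← numCycles_eq_cycleCount]
  congr 1
  rw [← sum_fin_ite_le]
  refine Fintype.sum_congr _ _ fun z => ?_
  by_cases hz : m ≤ (z : ℕ) <;> simp [hz]

theorem cHat_zero {m n : ℕ} (hn : n ≠ 0) : cHat m n 0 = 0 := by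
  classical
  rw [cHat_eq_sum]
  refine Finset.sum_eq_zero fun σ _ => if_neg ?_
  rintro ⟨h, -⟩
  have : NeZero n := ⟨hn⟩
  have hne : Nonempty (Quotient (Perm.SameCycle.setoid σ)) := ⟨Quotient.mk _ 0⟩
  rw [numCycles_eq_cycleCount, cycleCount] at h
  exact Nat.card_pos.ne' h

theorem cHat_self (m k : ℕ) : cHat m m k = if k = m then 1 else 0 := by
  classical
  rw [cHat_eq_sum, Finset.sum_eq_single 1]
  · have h : numCycles (1 : Perm (Fin m)) = m := by
      rw [numCycles_eq_cycleCount, cycleCount_eq_card_cycleType]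
      simp
    refine if_congr ?_ rfl rfl
    rw [h, eq_comm, and_iff_left]
    exact fun i _ => rfl
  · intro σ _ hσ
    refine if_neg fun h => hσ (Equiv.ext fun i => h.2 i i.isLt)
  · simp

/-- The guard `m ≤ k` encodes `C(n, j) = 0` for `j < 0`, since `k - m` is truncated. -/
theorem cHat_eq_stirlingFirst {m n : ℕ} (hmn : m ≤ n) (k : ℕ) :
    cHat m n k = if m ≤ k then Nat.stirlingFirst (n - m) (k - m) else 0 := by
  obtain ⟨N, rfl⟩ := Nat.exists_eq_add_of_le hmn
  clear hmn
  rw [Nat.add_sub_cancel_left]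
  induction N generalizing k with
  | zero =>
    rw [add_zero, cHat_self]
    rcases lt_trichotomy k m with h | rfl | h
    · rw [if_neg h.ne, if_neg (by omega)]
    · simp
    · rw [if_neg h.ne', if_pos h.le, Nat.stirlingFirst_eq_zero_of_lt (by omega)]
  | succ N ih =>
    obtain _ | k := k
    · rw [cHat_zero (by omega)]
      split_ifs with h
      · simp
      · rfl
    · rw [← add_assoc, cHat_succ (by omega), ih, ih, Nat.add_sub_cancel_left]
      rcases lt_trichotomy m (k + 1) with h | rfl | h
      · rw [if_pos (by omega), if_pos h.le, if_pos h.le, show k + 1 - m = (k - m) + 1 by omega,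
          Nat.stirlingFirst_succ_succ]
        ring
      · simp
        cases N <;> simp
      · rw [if_neg (by omega), if_neg (by omega), if_neg (by omega)]
        rfl

theorem sum_offCount_eq_mul_isolatedCount {m n : ℕ} (hmn : m < n) (k : ℕ) {a : Fin (n + 1)}
    (ha : m ≤ a) [DecidablePred fun π : Perm (Fin (n + 1)) => numCycles π = k ∧ FixesFirst m π] :
    ∑ π : Perm (Fin (n + 1)), (if numCycles π = k ∧ FixesFirst m π then offCount a π else 0) =
      (n - m) * isolatedCount (Nat.Partition.indiscrete n) m k := by
  classical
  have hnt : Nontrivial (Option (Fin n)) := ⟨none, some ⟨0, by omega⟩, by simp⟩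
  have hoff : ∀ τ, offCount a ((finSuccEquiv' a).symm.permCongr τ) = offCount none τ := by
    intro τ
    rw [← offCount_permCongr (finSuccEquiv' a).symm none τ, finSuccEquiv'_symm_none]
  rw [sum_perm_fin_succ a, Fintype.sum_option, isolatedCount_indiscrete_eq_sum (by omega)]
  simp only [hoff, numCycles_permCongr, fixesFirst_insertNone_none ha,
    fixesFirst_insertNone_some ha, cycleCount_insertNone_none, cycleCount_insertNone_some,
    ← numCycles_eq_cycleCount, offCount_none_insertNone,
    offCount_eq_zero (insertNone_none none _), ite_self, Finset.sum_const_zero, zero_add]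
  rw [← sum_fin_ite_le]
  refine Fintype.sum_congr _ _ fun z => ?_
  by_cases hz : m ≤ (z : ℕ) <;> simp [hz]

theorem two_mul_factorial_mul_cHat {m n k : ℕ} (hmn : m < n) (hk : Even (n + k)) :
    2 * (n - 1).factorial * cHat m (n + 1) k =
      (n + 1 - m) * ((n - m) * isolatedCount (Nat.Partition.indiscrete n) m k) := by
  classical
  have hnt : Nontrivial (Fin (n + 1)) := Fin.nontrivial_iff_two_le.2 (by omega)
  have h1 : 2 * (n - 1).factorial * cHat m (n + 1) k = ∑ π : Perm (Fin (n + 1)),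
      if numCycles π = k ∧ FixesFirst m π then ∑ a, offCount a π else 0 := by
    rw [cHat_eq_sum, Finset.mul_sum]
    refine Fintype.sum_congr _ _ fun π => ?_
    split_ifs with h
    · rw [mul_one, sum_offCount_of_sign_eq_neg_one (n - 1) (by simp; omega)]
      rw [sign_eq_neg_one_pow_cycleCount, ← numCycles_eq_cycleCount, h.1, Fintype.card_fin]
      exact Odd.neg_one_pow (by rw [add_right_comm]; exact hk.add_one)
    · simp
  rw [h1, ← sum_fin_ite_le]
  have h2 : ∀ π : Perm (Fin (n + 1)),
      (if numCycles π = k ∧ FixesFirst m π then ∑ a, offCount a π else 0) =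
        ∑ a, if numCycles π = k ∧ FixesFirst m π then offCount a π else 0 := by
    intro π
    split_ifs <;> simp
  rw [Fintype.sum_congr _ _ h2, Finset.sum_comm]
  refine Fintype.sum_congr _ _ fun a => ?_
  split_ifs with ha
  · exact sum_offCount_eq_mul_isolatedCount hmn k ha
  -- Here `a < m`, so `π` fixes `a` and `π * D` cannot be a full cycle.
  · refine Finset.sum_eq_zero fun π _ => ?_
    split_ifs with h
    · exact offCount_eq_zero (h.2 a (by omega))
    · rfl

end PlanePermutation

theorem mainTheorem4 :
    (∀ m n k : ℕ, m < n → Even ((n : ℤ) - (k : ℤ)) →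
      (PlanePermutation.isolatedCount (Nat.Partition.indiscrete n) m k : ℚ) =
        2 * ((n - 1).factorial : ℚ) * (PlanePermutation.cHat m (n + 1) k : ℚ) /
          (((n : ℚ) - (m : ℚ)) * ((n : ℚ) + 1 - (m : ℚ)))) ∧
    (∀ m n k : ℕ, m ≤ n →
      PlanePermutation.cHat m n k =
        if m ≤ k then Nat.stirlingFirst (n - m) (k - m) else 0) := by
  refine ⟨fun m n k hmn hk => ?_, fun m n k hmn => PlanePermutation.cHat_eq_stirlingFirst hmn k⟩
  have hk' : Even (n + k) := by
    have h : Even ((n : ℤ) + k) := by simpa [Int.even_sub, Int.even_add] using hk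
    exact_mod_cast h
  have h := congrArg (Nat.cast : ℕ → ℚ) (PlanePermutation.two_mul_factorial_mul_cHat hmn hk')
  push_cast [Nat.cast_sub hmn.le, Nat.cast_sub (show m ≤ n + 1 by omega)] at h
  have hm : (m : ℚ) < n := by exact_mod_cast hmn
  rw [eq_div_iff (mul_ne_zero (by linarith) (by linarith)), h]
  ring
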